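/- For a complex square matrix $X$, let $\mathrm{ind}(X)$ be the smallest integer $k\ge 0$ with $\mathrm{rank}(X^{k})=\mathrm{rank}(X^{k+1})$. Let $X^d$ denote the Drazin inverse of $X$, i.e. the unique matrix with $$XX^d=X^dX,\qquad X^dXX^d=X^d,\qquad X^{k}=X^{k+1}X^d,\qquad k=\mathrm{ind}(X),$$ and write $X^\pi=I-XX^d$. Let $A\in\mathbb{C}^{m\times m}$, $B\in\mathbb{C}^{m\times p}$, $C\in\mathbb{C}^{p\times m}$, $D\in\mathbb{C}^{p\times p}$, and put $$M=\begin{bmatrix}A&B\\C&D\end{bmatrix},\qquad Z=D-CA^dB,\qquad W=AA^d+A^dBCA^d,\qquad Q=\begin{bmatrix}A^2A^d&AA^dB\\CAA^d&CA^dB\end{bmatrix}.$$ Then $$Q^{d}=\begin{bmatrix}I\\CA^{d}\end{bmatrix}\,[(AW)^d]^2A\,\begin{bmatrix}I&A^{d}B\end{bmatrix},$$ and the following hold. (i) If $Z=0$ and $CA^\pi=0$, then $$M^d=Q^d+\sum_{j=1}^{n-1}\begin{bmatrix}0&A^{j-1}A^\pi B\\0&0\end{bmatrix}(Q^{d})^{j+1},$$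 where $n-1=\mathrm{ind}(A)$ (the sum is $0$ if $\mathrm{ind}(A)=0$). (ii) If $Z=0$, $A^\pi B=0$ and $BCA^\pi=0$, then $M^d=Q^d$. -/

import Mathlib

/-- The index of a complex square matrix: the smallest non-negative integer `k` such that
`rank (A ^ k) = rank (A ^ (k + 1))`. -/
noncomputable def matIndex {ι : Type*} [Fintype ι] [DecidableEq ι] (A : Matrix ι ι ℂ) : ℕ :=
  sInf {k : ℕ | (A ^ k).rank = (A ^ (k + 1)).rank}

/-- `X` satisfies the three equations that define the Drazin inverse of `A`. -/
def IsDrazinInverse {ι : Type*} [Fintype ι] [DecidableEq ι] (A X : Matrix ι ι ℂ) : Prop :=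
  A * X = X * A ∧ X * A * X = X ∧ A ^ matIndex A = A ^ (matIndex A + 1) * X

theorem exists_drazin_of_some_exponent {ι : Type*} [Fintype ι] [DecidableEq ι]
    (A : Matrix ι ι ℂ) :
    ∃ (K : ℕ) (X : Matrix ι ι ℂ), A * X = X * A ∧ X * A * X = X ∧ A ^ K = A ^ (K + 1) * X := by
  obtain ⟨q, hq, hnd⟩ := Polynomial.exists_eq_pow_rootMultiplicity_mul_and_not_dvd
    A.charpoly (Matrix.charpoly_monic A).ne_zero 0
  generalize Polynomial.rootMultiplicity 0 A.charpoly = K at hq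
  rw [Polynomial.C_0, sub_zero] at hq hnd
  have hq0 : q.coeff 0 ≠ 0 := fun h => hnd (Polynomial.X_dvd_iff.2 h)
  have h0 : A ^ K * Polynomial.aeval A q = 0 := by
    have h := Matrix.aeval_self_charpoly A
    rw [hq] at h
    simpa using h
  rw [← Polynomial.X_mul_divX_add q] at h0
  simp only [map_add, map_mul, Polynomial.aeval_X, Polynomial.aeval_C,
    Algebra.algebraMap_eq_smul_one] at h0
  have hcomm : Commute A (Polynomial.aeval A q.divX) := by
    have h := (Polynomial.aeval A).congr_arg (mul_comm Polynomial.X q.divX)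
    simp only [map_mul, Polynomial.aeval_X] at h
    exact h
  generalize Polynomial.aeval A q.divX = r at h0 hcomm
  obtain ⟨c, hc, hAc⟩ : ∃ c : Matrix ι ι ℂ, Commute A c ∧ A ^ K = A ^ (K + 1) * c := by
    refine ⟨(-(q.coeff 0)⁻¹) • r, hcomm.smul_right _, ?_⟩
    rw [mul_add, ← mul_assoc, ← pow_succ, mul_smul_comm, mul_one] at h0
    rw [mul_smul_comm, eq_neg_of_add_eq_zero_left h0, smul_neg, neg_smul, neg_neg, smul_smul,
      inv_mul_cancel₀ hq0, one_smul]
  have hj : ∀ j : ℕ, A ^ (K + j) * c ^ j = A ^ K := by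
    intro j
    induction j with
    | zero => simp
    | succ j ih =>
      have e1 : A ^ (K + (j + 1)) * c ^ (j + 1) = A ^ j * (A ^ (K + 1) * c) * c ^ j := by
        rw [pow_succ' c j, ← mul_assoc, ← mul_assoc, ← pow_add]
        congr 3
        omega
      rw [e1, ← hAc, ← pow_add, add_comm j K, ih]
  have hAX : Commute A (A ^ K * c ^ (K + 1)) :=
    ((Commute.refl A).pow_right K).mul_right (hc.pow_right (K + 1))
  refine ⟨K, A ^ K * c ^ (K + 1), hAX, ?_, ?_⟩
  · have e : A ^ K * c ^ (K + 1) * A * (A ^ K * c ^ (K + 1))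
        = A ^ (K + (K + 1)) * c ^ (K + 1) * c ^ (K + 1) := by
      have h1 : c ^ (K + 1) * (A * A ^ K) = (A * A ^ K) * c ^ (K + 1) := by
        rw [← pow_succ']
        exact ((hc.symm.pow_left (K + 1)).pow_right (K + 1)).eq
      calc A ^ K * c ^ (K + 1) * A * (A ^ K * c ^ (K + 1))
          = A ^ K * (c ^ (K + 1) * (A * A ^ K)) * c ^ (K + 1) := by simp only [mul_assoc]
        _ = A ^ K * (A * A ^ K) * c ^ (K + 1) * c ^ (K + 1) := by
            rw [h1]; simp only [mul_assoc]
        _ = _ := by rw [← pow_succ', ← pow_add]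
    rw [e, hj]
  · rw [← mul_assoc, ← pow_add, add_comm (K + 1) K, hj]

theorem mul_eq_zero_of_rank_pow_eq {ι : Type*} [Fintype ι] [DecidableEq ι]
    (A Y : Matrix ι ι ℂ) (k : ℕ) (hk : (A ^ k).rank = (A ^ (k + 1)).rank)
    (hY : A ^ (k + 1) * Y = 0) : A ^ k * Y = 0 := by
  have hle : LinearMap.ker (A ^ k).mulVecLin ≤ LinearMap.ker (A ^ (k + 1)).mulVecLin := by
    intro v hv
    rw [LinearMap.mem_ker, Matrix.mulVecLin_apply] at hv ⊢
    rw [pow_succ', ← Matrix.mulVec_mulVec, hv, Matrix.mulVec_zero]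
  have heq := Submodule.eq_of_le_of_finrank_eq hle (by
    have h1 := LinearMap.finrank_range_add_finrank_ker (A ^ k).mulVecLin
    have h2 := LinearMap.finrank_range_add_finrank_ker (A ^ (k + 1)).mulVecLin
    unfold Matrix.rank at hk
    omega)
  ext i j
  have hv : Y.col j ∈ LinearMap.ker (A ^ (k + 1)).mulVecLin := by
    rw [LinearMap.mem_ker, Matrix.mulVecLin_apply]
    ext l
    exact congrFun (congrFun hY l) j
  rw [← heq, LinearMap.mem_ker, Matrix.mulVecLin_apply] at hv
  exact congrFun hv i

/-- Every complex square matrix has exactly one Drazin inverse. -/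
theorem existsUnique_isDrazinInverse {ι : Type*} [Fintype ι] [DecidableEq ι]
    (A : Matrix ι ι ℂ) : ∃! X : Matrix ι ι ℂ, IsDrazinInverse A X := by
  obtain ⟨K, X, h1, h2, h3⟩ := exists_drazin_of_some_exponent A
  have hne : {k : ℕ | (A ^ k).rank = (A ^ (k + 1)).rank}.Nonempty := by
    refine ⟨K, le_antisymm ?_ ?_⟩
    · conv_lhs => rw [h3]
      exact Matrix.rank_mul_le_left _ _
    · rw [pow_succ]
      exact Matrix.rank_mul_le_left _ _
  have hind : (A ^ matIndex A).rank = (A ^ (matIndex A + 1)).rank := Nat.sInf_mem hne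
  have hdesc : ∀ (j : ℕ) (Y : Matrix ι ι ℂ), A ^ (matIndex A + j) * Y = 0 →
      A ^ matIndex A * Y = 0 := by
    intro j
    induction j with
    | zero => intro Y h; simpa using h
    | succ j ih =>
      intro Y h
      have h' := ih (A * Y) (by rw [← mul_assoc, ← pow_succ]; exact h)
      refine mul_eq_zero_of_rank_pow_eq A Y _ hind ?_
      rw [pow_succ, mul_assoc]
      exact h'
  have hX : A ^ matIndex A = A ^ (matIndex A + 1) * X := by
    have h0 : A ^ (matIndex A + K) * (1 - A * X) = 0 := by
      rw [pow_add, mul_assoc, mul_sub, mul_one, ← mul_assoc (A ^ K), ← pow_succ, ← h3, sub_self,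
        mul_zero]
    have h := hdesc K _ h0
    rw [mul_sub, mul_one, ← mul_assoc, ← pow_succ] at h
    exact sub_eq_zero.1 h
  refine ⟨X, ⟨h1, h2, hX⟩, ?_⟩
  rintro Y ⟨g1, g2, g3⟩
  generalize matIndex A = k at hX g3
  have key : ∀ Z : Matrix ι ι ℂ, A * Z = Z * A → Z * A * Z = Z → ∀ j : ℕ,
      Z = Z ^ (j + 1) * A ^ j ∧ Z = A ^ j * Z ^ (j + 1) := by
    intro Z c1 c2 j
    have hc : Commute A Z := c1
    have hz : Z = Z ^ (j + 1) * A ^ j := by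
      induction j with
      | zero => simp
      | succ j ih =>
        have e : Z ^ (j + 1 + 1) * A ^ (j + 1) = Z * (Z ^ (j + 1) * A ^ j) * A := by
          rw [pow_succ' Z (j + 1), pow_succ A j]
          simp only [mul_assoc]
        rw [e, ← ih, mul_assoc, ← c1, ← mul_assoc, c2]
    refine ⟨hz, ?_⟩
    rw [((hc.pow_left j).pow_right (j + 1)).eq]
    exact hz
  have hX' : X = X * A * Y := by
    have e := (key X h1 h2 k).1
    have hc : Commute X A := h1.symm
    calc X = X ^ (k + 1) * (A ^ (k + 1) * Y) := by rw [← g3]; exact e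
      _ = (X ^ (k + 1) * A ^ k) * A * Y := by rw [pow_succ A k]; simp only [mul_assoc]
      _ = X * A * Y := by rw [← e]
  have hY' : Y = X * A * Y := by
    have e := (key Y g1 g2 k).2
    have hc : Commute A X := h1
    calc Y = (A ^ (k + 1) * X) * Y ^ (k + 1) := by rw [← hX]; exact e
      _ = X * A * (A ^ k * Y ^ (k + 1)) := by
          rw [(hc.pow_left (k + 1)).eq, pow_succ' A k]; simp only [mul_assoc]
      _ = X * A * Y := by rw [← e]
  rw [hY', ← hX']

/-- The Drazin inverse of a complex square matrix. -/
noncomputable def drazinInv {ι : Type*} [Fintype ι] [DecidableEq ι] (A : Matrix ι ι ℂ) :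
    Matrix ι ι ℂ :=
  (existsUnique_isDrazinInverse A).choose

/-- `A^π = I - A A^d`. -/
noncomputable def drazinPi {ι : Type*} [Fintype ι] [DecidableEq ι] (A : Matrix ι ι ℂ) :
    Matrix ι ι ℂ :=
  1 - A * drazinInv A

/-- The generalized Schur complement `Z = D - C A^d B`. -/
noncomputable def genSchur {m n : ℕ} (A : Matrix (Fin m) (Fin m) ℂ) (B : Matrix (Fin m) (Fin n) ℂ)
    (C : Matrix (Fin n) (Fin m) ℂ) (D : Matrix (Fin n) (Fin n) ℂ) : Matrix (Fin n) (Fin n) ℂ :=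
  D - C * drazinInv A * B

/-- `W = A A^d + A^d B C A^d`. -/
noncomputable def blockW {m n : ℕ} (A : Matrix (Fin m) (Fin m) ℂ) (B : Matrix (Fin m) (Fin n) ℂ)
    (C : Matrix (Fin n) (Fin m) ℂ) : Matrix (Fin m) (Fin m) ℂ :=
  A * drazinInv A + drazinInv A * B * C * drazinInv A

/-- The block matrix `Q = [[A² A^d, A A^d B], [C A A^d, C A^d B]]`. -/
noncomputable def blockQ {m n : ℕ} (A : Matrix (Fin m) (Fin m) ℂ) (B : Matrix (Fin m) (Fin n) ℂ)
    (C : Matrix (Fin n) (Fin m) ℂ) : Matrix (Fin m ⊕ Fin n) (Fin m ⊕ Fin n) ℂ :=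
  Matrix.fromBlocks (A ^ 2 * drazinInv A) (A * drazinInv A * B)
    (C * A * drazinInv A) (C * drazinInv A * B)

/-- The block product `[I; C A^d] [(A W)^d]² A [I, A^d B]`, the explicit expression for `Q^d`. -/
noncomputable def blockQd {m n : ℕ} (A : Matrix (Fin m) (Fin m) ℂ) (B : Matrix (Fin m) (Fin n) ℂ)
    (C : Matrix (Fin n) (Fin m) ℂ) : Matrix (Fin m ⊕ Fin n) (Fin m ⊕ Fin n) ℂ :=
  Matrix.fromRows (1 : Matrix (Fin m) (Fin m) ℂ) (C * drazinInv A) *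
    drazinInv (A * blockW A B C) ^ 2 * A *
    Matrix.fromCols (1 : Matrix (Fin m) (Fin m) ℂ) (drazinInv A * B)

/-! The matrix `Q` factors as `X * Y` with `X = [I; C A^d]` and `Y = A (A A^d) [I, A^d B]`, and `Y *
X = A W`; Cline's formula (`IsDrazin.cline`) then gives `Q^d`. For (i) and (ii), `Z = 0` lets one
write `M = N + Q`, where `N` is built from `A^π` and is nilpotent, and the remaining hypotheses give
`Q N = 0`. In that situation `M^d = ∑ N^j (Q^d)^(j+1)` (`IsDrazin.add_of_mul_eq_zero`). In (i) the
diagonal part of `N^j` kills `Q^d`; in (ii) `N Q = 0`, so only `j = 0` survives. Leaving the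
exponent in `IsDrazin` free means that the index of `M` or `Q` never has to be computed. -/

/-- `x` is a Drazin inverse of `a` in a monoid, with an unspecified exponent in the third
equation. -/
def IsDrazin {R : Type*} [Monoid R] (a x : R) : Prop :=
  a * x = x * a ∧ x * a * x = x ∧ ∃ k : ℕ, a ^ k = a ^ (k + 1) * x

/-! ### Uniqueness of Drazin inverses in a monoid -/

section Monoid

variable {R : Type*} [Monoid R] {a x y : R}

theorem pow_add_eq_pow_add_succ_mul {k : ℕ} (h : a ^ k = a ^ (k + 1) * x)
    (j : ℕ) : a ^ (k + j) = a ^ (k + j + 1) * x := by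
  calc a ^ (k + j) = a ^ j * a ^ k := by rw [add_comm, pow_add]
    _ = a ^ j * (a ^ (k + 1) * x) := by rw [← h]
    _ = a ^ (k + j + 1) * x := by rw [← mul_assoc, ← pow_add]; congr 2; omega

namespace IsDrazin

theorem eq_pow_mul_pow (h : IsDrazin a x) (j : ℕ) : x = x ^ (j + 1) * a ^ j := by
  obtain ⟨h1, h2, -⟩ := h
  induction j with
  | zero => simp
  | succ j ih =>
    have e : x ^ (j + 1 + 1) * a ^ (j + 1) = x * (x ^ (j + 1) * a ^ j) * a := by
      rw [pow_succ' x (j + 1), pow_succ a j]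
      simp only [mul_assoc]
    rw [e, ← ih, mul_assoc, ← h1, ← mul_assoc, h2]

theorem eq_pow_mul_pow' (h : IsDrazin a x) (j : ℕ) : x = a ^ j * x ^ (j + 1) := by
  rw [((show Commute a x from h.1).pow_left j |>.pow_right (j + 1)).eq]
  exact h.eq_pow_mul_pow j

theorem unique (hx : IsDrazin a x) (hy : IsDrazin a y) : x = y := by
  obtain ⟨k, hk⟩ := hx.2.2
  obtain ⟨l, hl⟩ := hy.2.2
  have hcx : Commute a x := hx.1
  have hkl := pow_add_eq_pow_add_succ_mul hk l
  have hlk := pow_add_eq_pow_add_succ_mul hl k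
  rw [add_comm l k] at hlk
  -- Both third equations now hold at a common exponent, so both inverses can be compared with `x *
  -- a * y`.
  generalize k + l = r at hkl hlk
  have hX : x = x * a * y := by
    calc x = x ^ (r + 1) * (a ^ (r + 1) * y) := by rw [← hlk]; exact hx.eq_pow_mul_pow r
      _ = (x ^ (r + 1) * a ^ r) * a * y := by rw [pow_succ a r]; simp only [mul_assoc]
      _ = x * a * y := by rw [← hx.eq_pow_mul_pow r]
  have hY : y = x * a * y := by
    calc y = (a ^ (r + 1) * x) * y ^ (r + 1) := by rw [← hkl]; exact hy.eq_pow_mul_pow' r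
      _ = x * a * (a ^ r * y ^ (r + 1)) := by
          rw [(hcx.pow_left (r + 1)).eq, pow_succ' a r]; simp only [mul_assoc]
      _ = x * a * y := by rw [← hy.eq_pow_mul_pow' r]
  rw [hY, ← hX]

end IsDrazin

end Monoid

/-- Drazin inverse of a sum `n + q` with `n` nilpotent and `q * n = 0`. -/
theorem IsDrazin.add_of_mul_eq_zero {R : Type*} [Ring R] {n q y : R} (hy : IsDrazin q y)
    (hqn : q * n = 0) {s : ℕ} (hn : n ^ (s + 1) = 0) :
    IsDrazin (n + q) (∑ j ∈ Finset.range (s + 1), n ^ j * y ^ (j + 1)) := by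
  obtain ⟨h1, h2, k, hk⟩ := hy
  have hyn : y * n = 0 := by
    calc y * n = y * (y * q) * n := by rw [← h1, ← mul_assoc, h2]
      _ = y * y * (q * n) := by simp only [mul_assoc]
      _ = 0 := by rw [hqn, mul_zero]
  have hyq : ∀ j : ℕ, y ^ (j + 1 + 1) * q = y ^ (j + 1) := fun j => by
    rw [pow_succ, pow_succ, mul_assoc, mul_assoc, ← h1, ← mul_assoc y, h2]
  set x := ∑ j ∈ Finset.range (s + 1), n ^ j * y ^ (j + 1) with hx
  -- Since `q * n = 0`, only the term `j = 0` survives.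
  have hqx : q * x = q * y := by
    rw [hx, Finset.sum_range_succ', mul_add, Finset.mul_sum, Finset.sum_eq_zero]
    · simp
    · intro j _
      rw [pow_succ' n j, mul_assoc, ← mul_assoc q, hqn, zero_mul]
  have hxn : x * n = 0 := by
    rw [hx, Finset.sum_mul]
    refine Finset.sum_eq_zero fun j _ => ?_
    rw [pow_succ y j, mul_assoc, mul_assoc, hyn, mul_zero, mul_zero]
  have hnx : n * x = ∑ j ∈ Finset.range s, n ^ (j + 1) * y ^ (j + 1) := by
    rw [hx, Finset.mul_sum, Finset.sum_range_succ, ← mul_assoc, ← pow_succ', hn, zero_mul,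
      add_zero]
    exact Finset.sum_congr rfl fun j _ => by rw [← mul_assoc, ← pow_succ']
  have hxq : x * q = n * x + q * y := by
    rw [hnx, hx, Finset.sum_mul, Finset.sum_range_succ', h1]
    congr 1
    · exact Finset.sum_congr rfl fun j _ => by rw [mul_assoc, hyq]
    · simp
  have hqyy : x * (q * y) = x := by
    rw [hx, Finset.sum_mul]
    refine Finset.sum_congr rfl fun j _ => ?_
    rw [h1, ← mul_assoc, mul_assoc (n ^ j), ← pow_succ, mul_assoc, hyq]
  refine ⟨?_, ?_, k + (s + 1), ?_⟩
  · rw [add_mul, mul_add, hqx, hxn, zero_add, hxq]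
  · rw [mul_add, hxn, zero_add, mul_assoc, hqx, hqyy]
  · have hqpow : ∀ j : ℕ, q * (n + q) ^ j = q ^ (j + 1) := by
      intro j
      induction j with
      | zero => simp
      | succ j ih =>
        rw [pow_succ, ← mul_assoc, ih, mul_add, pow_succ q j, mul_assoc _ q n, hqn, mul_zero,
          zero_add, ← pow_succ, ← pow_succ]
    -- Beyond exponent `k` the pure powers of `q` cancel, so each increment puts one more factor `n`
    -- on the left of the defect; `s + 1` increments kill it.
    have hstep : ∀ j : ℕ, (n + q) ^ (k + j + 1) - (n + q) ^ (k + j + 1 + 1) * x =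
        n * ((n + q) ^ (k + j) - (n + q) ^ (k + j + 1) * x) := by
      intro j
      have e := pow_add_eq_pow_add_succ_mul hk (j + 1)
      have hpow : ∀ i : ℕ, (n + q) ^ (i + 1) = n * (n + q) ^ i + q ^ (i + 1) := fun i => by
        rw [pow_succ', add_mul, hqpow]
      have e' : q ^ (k + j + 1 + 1) * x = q ^ (k + j + 1) := by
        rw [pow_succ q (k + j + 1), mul_assoc, hqx, ← mul_assoc, ← pow_succ]
        exact e.symm
      calc (n + q) ^ (k + j + 1) - (n + q) ^ (k + j + 1 + 1) * x
          = n * (n + q) ^ (k + j) + q ^ (k + j + 1) -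
              (n * (n + q) ^ (k + j + 1) + q ^ (k + j + 1 + 1)) * x := by rw [← hpow, ← hpow]
        _ = _ := by rw [add_mul, e', add_sub_add_right_eq_sub, mul_sub, mul_assoc]
    have hiter : ∀ j : ℕ, (n + q) ^ (k + j) - (n + q) ^ (k + j + 1) * x =
        n ^ j * ((n + q) ^ k - (n + q) ^ (k + 1) * x) := by
      intro j
      induction j with
      | zero => simp
      | succ j ih => rw [← add_assoc, hstep, ih, pow_succ' n j, mul_assoc]
    have := hiter (s + 1)
    rw [hn, zero_mul] at this
    exact sub_eq_zero.1 this

/-! ### Link with `drazinInv`, and Cline's formula -/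

section Matrix

variable {ι κ : Type*} [Fintype ι] [DecidableEq ι] [Fintype κ] [DecidableEq κ]

theorem isDrazin_drazinInv (A : Matrix ι ι ℂ) : IsDrazin A (drazinInv A) :=
  have h := (existsUnique_isDrazinInverse A).choose_spec.1
  ⟨h.1, h.2.1, _, h.2.2⟩

theorem pow_matIndex_mul_drazinPi (A : Matrix ι ι ℂ) : A ^ matIndex A * drazinPi A = 0 := by
  have h := (existsUnique_isDrazinInverse A).choose_spec.1.2.2
  change A ^ matIndex A = A ^ (matIndex A + 1) * drazinInv A at h
  rw [drazinPi, mul_sub, mul_one, ← mul_assoc, ← pow_succ, ← h, sub_self]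

theorem IsDrazin.drazinInv_eq {A X : Matrix ι ι ℂ} (h : IsDrazin A X) : drazinInv A = X :=
  (isDrazin_drazinInv A).unique h

/-- Cline's formula for rectangular matrices. -/
theorem IsDrazin.cline {X : Matrix ι κ ℂ} {Y : Matrix κ ι ℂ} {d : Matrix κ κ ℂ}
    (h : IsDrazin (Y * X) d) : IsDrazin (X * Y) (X * d ^ 2 * Y) := by
  obtain ⟨h1, h2, k, hk⟩ := h
  have hl : Y * X * d ^ 2 = d := by rw [pow_two, ← mul_assoc, h1, h2]
  have hr : d ^ 2 * (Y * X) = d := by rw [pow_two, mul_assoc, ← h1, ← mul_assoc, h2]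
  have e1 : X * Y * (X * d ^ 2 * Y) = X * d * Y := by
    conv_rhs => rw [← hl]
    simp only [Matrix.mul_assoc]
  have e2 : X * d ^ 2 * Y * (X * Y) = X * d * Y := by
    conv_rhs => rw [← hr]
    simp only [Matrix.mul_assoc]
  have hpow : ∀ j : ℕ, (X * Y) ^ (j + 1) = X * (Y * X) ^ j * Y := by
    intro j
    induction j with
    | zero => simp
    | succ j ih => rw [pow_succ, ih, pow_succ (Y * X)]; simp only [Matrix.mul_assoc]
  -- Regrouping `(X * Y) ^ (j + 1)` as `X * (Y * X) ^ j * Y` costs one in the exponent.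
  refine ⟨e1.trans e2.symm, ?_, k + 1, ?_⟩
  · calc X * d ^ 2 * Y * (X * Y) * (X * d ^ 2 * Y) = X * d * (Y * X * d ^ 2) * Y := by
          rw [e2]; simp only [Matrix.mul_assoc]
      _ = X * d ^ 2 * Y := by rw [hl, Matrix.mul_assoc X, ← pow_two]
  · calc (X * Y) ^ (k + 1) = X * ((Y * X) ^ (k + 1) * d) * Y := by rw [hpow, ← hk]
      _ = X * (Y * X) ^ k * Y * (X * d * Y) := by rw [pow_succ]; simp only [Matrix.mul_assoc]
      _ = (X * Y) ^ (k + 1 + 1) * (X * d ^ 2 * Y) := by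
          rw [← hpow, ← e1, ← mul_assoc, ← pow_succ]

end Matrix

/-! ### Block matrices: `Q` and the two splittings of `M` -/

section Blocks

variable {m n : ℕ} (A : Matrix (Fin m) (Fin m) ℂ) (B : Matrix (Fin m) (Fin n) ℂ)
  (C : Matrix (Fin n) (Fin m) ℂ)

theorem commute_drazinInv : A * drazinInv A = drazinInv A * A := (isDrazin_drazinInv A).1

theorem drazinInv_mul_mul_drazinInv : drazinInv A * (A * drazinInv A) = drazinInv A := by
  rw [← mul_assoc]; exact (isDrazin_drazinInv A).2.1

theorem mul_drazinInv_mul_drazinInv : A * drazinInv A * drazinInv A = drazinInv A := by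
  rw [commute_drazinInv, mul_assoc, drazinInv_mul_mul_drazinInv]

theorem mul_drazinPi : A * drazinPi A = drazinPi A * A := by
  rw [drazinPi, mul_sub, sub_mul, mul_one, one_mul, mul_assoc, ← commute_drazinInv]

theorem drazinInv_mul_drazinPi : drazinInv A * drazinPi A = 0 := by
  rw [drazinPi, mul_sub, mul_one, drazinInv_mul_mul_drazinInv, sub_self]

theorem drazinPi_mul_drazinInv : drazinPi A * drazinInv A = 0 := by
  rw [drazinPi, sub_mul, one_mul, mul_drazinInv_mul_drazinInv, sub_self]

theorem drazinPi_mul_mul_drazinInv : drazinPi A * (A * drazinInv A) = 0 := by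
  rw [commute_drazinInv, ← mul_assoc, drazinPi_mul_drazinInv, zero_mul]

theorem drazinPi_mul_self : drazinPi A * drazinPi A = drazinPi A := by
  calc drazinPi A * drazinPi A = (1 - A * drazinInv A) * drazinPi A := rfl
    _ = drazinPi A := by
      rw [sub_mul, one_mul, mul_assoc, drazinInv_mul_drazinPi, mul_zero, sub_zero]

theorem blockQ_eq_mul : blockQ A B C = Matrix.fromRows 1 (C * drazinInv A) *
    (A * (A * drazinInv A) * Matrix.fromCols 1 (drazinInv A * B)) := by
  have e1 : drazinInv A * (A * (A * drazinInv A)) = A * drazinInv A := by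
    rw [← mul_assoc, ← commute_drazinInv, mul_assoc, drazinInv_mul_mul_drazinInv]
  have e2 : A * (A * drazinInv A) * (drazinInv A * B) = A * drazinInv A * B := by
    rw [← Matrix.mul_assoc, mul_assoc, mul_drazinInv_mul_drazinInv]
  rw [Matrix.mul_fromCols, Matrix.fromRows_mul_fromCols, blockQ, e2]
  simp only [Matrix.mul_one, Matrix.one_mul]
  congr 1
  · rw [pow_two, mul_assoc]
  · rw [Matrix.mul_assoc C (drazinInv A), e1, Matrix.mul_assoc]
  · rw [Matrix.mul_assoc C (drazinInv A) (_ * _), ← Matrix.mul_assoc (drazinInv A),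
      drazinInv_mul_mul_drazinInv, Matrix.mul_assoc]

theorem mul_blockW_eq : A * (A * drazinInv A) *
    Matrix.fromCols (1 : Matrix (Fin m) (Fin m) ℂ) (drazinInv A * B) *
    Matrix.fromRows (1 : Matrix (Fin m) (Fin m) ℂ) (C * drazinInv A) = A * blockW A B C := by
  rw [Matrix.mul_assoc, Matrix.fromCols_mul_fromRows, mul_assoc, blockW, mul_add (A * drazinInv A)]
  simp only [Matrix.mul_one, ← Matrix.mul_assoc]
  rw [mul_drazinInv_mul_drazinInv]

theorem blockW_mul_drazinPi : blockW A B C * drazinPi A = 0 := by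
  rw [blockW, add_mul, mul_assoc, mul_assoc _ (drazinInv A), drazinInv_mul_drazinPi, mul_zero,
    mul_zero, add_zero]

/-- Cline's formula yields the claimed expression with an extra factor `A A^d`. It is absorbed
because `W A^π = 0` forces `(A W)^d A^π = 0`. -/
theorem isDrazin_blockQ : IsDrazin (blockQ A B C) (blockQd A B C) := by
  have h := isDrazin_drazinInv (A * blockW A B C)
  have hz : drazinInv (A * blockW A B C) * drazinPi A = 0 := by
    have e := h.eq_pow_mul_pow 1
    rw [pow_one] at e
    rw [e, mul_assoc, mul_assoc A, blockW_mul_drazinPi, mul_zero, mul_zero]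
  have hA : drazinInv (A * blockW A B C) ^ 2 * (A * (A * drazinInv A)) =
      drazinInv (A * blockW A B C) ^ 2 * A := by
    have e : A * (A * drazinInv A) = A - drazinPi A * A := by
      rw [← mul_drazinPi, drazinPi, mul_sub, mul_one, sub_sub_cancel]
    rw [e, mul_sub, pow_two, ← mul_assoc, mul_assoc _ _ (drazinPi A), hz, mul_zero, zero_mul,
      sub_zero]
  have hc : IsDrazin _ _ := IsDrazin.cline (X := Matrix.fromRows 1 (C * drazinInv A))
    (Y := A * (A * drazinInv A) * Matrix.fromCols 1 (drazinInv A * B))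
    (d := drazinInv (A * blockW A B C)) (by rw [mul_blockW_eq]; exact h)
  rw [← blockQ_eq_mul, Matrix.mul_assoc, ← Matrix.mul_assoc (_ ^ 2), hA] at hc
  rw [blockQd]
  simpa only [Matrix.mul_assoc] using hc

/-- `Q^d = Q (Q^d)^2`, so whatever kills `Q` from the left kills `Q^d`. -/
theorem mul_blockQd_eq_zero {N : Matrix (Fin m ⊕ Fin n) (Fin m ⊕ Fin n) ℂ}
    (h : N * blockQ A B C = 0) : N * blockQd A B C = 0 := by
  have e := (isDrazin_blockQ A B C).eq_pow_mul_pow' 1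
  rw [e, pow_one, ← mul_assoc, h, zero_mul]

theorem pow_mul_drazinPi_eq_zero {k : ℕ} (hk : matIndex A ≤ k) : A ^ k * drazinPi A = 0 := by
  obtain ⟨j, rfl⟩ := Nat.exists_eq_add_of_le' hk
  rw [pow_add, mul_assoc, pow_matIndex_mul_drazinPi, mul_zero]

theorem commute_pow_drazinPi (k : ℕ) : A ^ k * drazinPi A = drazinPi A * A ^ k :=
  (show Commute A (drazinPi A) from mul_drazinPi A).pow_left k

theorem drazinInv_fromBlocks_of_mul_drazinPi_eq_zero (D : Matrix (Fin n) (Fin n) ℂ)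
    (hZ : genSchur A B C D = 0) (hC : C * drazinPi A = 0) :
    drazinInv (Matrix.fromBlocks A B C D) = blockQd A B C +
      ∑ j ∈ Finset.Icc 1 (matIndex A),
        Matrix.fromBlocks 0 (A ^ (j - 1) * drazinPi A * B) 0 0 * blockQd A B C ^ (j + 1) := by
  set N : Matrix (Fin m ⊕ Fin n) (Fin m ⊕ Fin n) ℂ :=
    Matrix.fromBlocks (A * drazinPi A) (drazinPi A * B) 0 0 with hN
  have hC' : C * (A * drazinInv A) = C := by
    rw [drazinPi, Matrix.mul_sub, Matrix.mul_one, sub_eq_zero] at hC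
    exact hC.symm
  have hsum : Matrix.fromBlocks A B C D = N + blockQ A B C := by
    rw [hN, blockQ, Matrix.fromBlocks_add, Matrix.mul_assoc C, hC', zero_add, zero_add,
      ← sub_eq_zero.1 hZ, drazinPi, mul_sub, Matrix.sub_mul, mul_one, Matrix.one_mul, pow_two,
      ← mul_assoc, sub_add_cancel, sub_add_cancel]
  have hQN : blockQ A B C * N = 0 := by
    have hA : A ^ 2 * drazinInv A * drazinPi A = 0 := by
      rw [mul_assoc, drazinInv_mul_drazinPi, mul_zero]
    rw [hN, blockQ, Matrix.fromBlocks_multiply, Matrix.mul_assoc C, hC', mul_drazinPi]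
    simp only [← Matrix.mul_assoc, hC, hA, Matrix.zero_mul, Matrix.mul_zero, add_zero,
      Matrix.fromBlocks_zero]
  have hpow : ∀ j : ℕ, N ^ (j + 1) =
      Matrix.fromBlocks (A ^ (j + 1) * drazinPi A) (A ^ j * drazinPi A * B) 0 0 := by
    intro j
    induction j with
    | zero => simp [hN]
    | succ j ih =>
      rw [pow_succ, ih, hN, Matrix.fromBlocks_multiply]
      simp only [Matrix.zero_mul, Matrix.mul_zero, add_zero]
      congr 1
      · rw [mul_drazinPi, mul_assoc, ← mul_assoc (drazinPi A), drazinPi_mul_self, ← mul_drazinPi,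
          ← mul_assoc, ← pow_succ]
      · rw [← Matrix.mul_assoc, mul_assoc _ (drazinPi A), drazinPi_mul_self]
  -- The off-diagonal block of `N ^ (j + 1)` carries only `A ^ j`, hence one power beyond the index.
  have hnil : N ^ (matIndex A + 1) = 0 := by
    rw [hpow, pow_mul_drazinPi_eq_zero A (Nat.le_succ _), pow_mul_drazinPi_eq_zero A le_rfl,
      Matrix.zero_mul, Matrix.fromBlocks_zero]
  -- The diagonal part of `N ^ (j + 1)` annihilates `Q`, since `A^π` kills the factor `A A^d` in its
  -- top row.
  have hL : ∀ j : ℕ, Matrix.fromBlocks (A ^ (j + 1) * drazinPi A)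
      (0 : Matrix (Fin m) (Fin n) ℂ) 0 (0 : Matrix (Fin n) (Fin n) ℂ) * blockQd A B C = 0 := by
    intro j
    refine mul_blockQd_eq_zero A B C ?_
    have hA : drazinPi A * (A ^ 2 * drazinInv A) = 0 := by
      rw [← mul_assoc, ← commute_pow_drazinPi, mul_assoc, drazinPi_mul_drazinInv, mul_zero]
    rw [blockQ, Matrix.fromBlocks_multiply, mul_assoc (_ ^ _), hA,
      ← Matrix.mul_assoc _ _ B, mul_assoc (_ ^ _) _ (_ * _), drazinPi_mul_mul_drazinInv]
    simp
  rw [hsum, ((isDrazin_blockQ A B C).add_of_mul_eq_zero hQN hnil).drazinInv_eq,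
    Finset.sum_range_succ', pow_zero, one_mul, zero_add, pow_one, add_comm,
    Finset.range_eq_Ico, Finset.sum_Ico_add' (fun j => N ^ j * blockQd A B C ^ (j + 1)), zero_add]
  congr 1
  refine Finset.sum_congr rfl fun j hj => ?_
  obtain ⟨i, rfl⟩ := Nat.exists_eq_add_of_le' (Finset.mem_Ico.1 hj).1
  have hsplit : N ^ (i + 1) = Matrix.fromBlocks (A ^ (i + 1) * drazinPi A) 0 0 0 +
      Matrix.fromBlocks 0 (A ^ i * drazinPi A * B) 0 0 := by
    simp [hpow, Matrix.fromBlocks_add]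
  rw [hsplit, Nat.add_sub_cancel, add_mul, pow_succ' (blockQd A B C), ← mul_assoc, hL, zero_mul, zero_add]

/-- Here the remainder `N` sits in the first block column. `B C A^π = 0` gives `Q N = 0`, while `A^π
B = 0` gives `N Q = 0`, which removes every term with `j ≥ 1`. -/
theorem drazinInv_fromBlocks_of_drazinPi_mul_eq_zero (D : Matrix (Fin n) (Fin n) ℂ)
    (hZ : genSchur A B C D = 0) (hB : drazinPi A * B = 0) (hBC : B * C * drazinPi A = 0) :
    drazinInv (Matrix.fromBlocks A B C D) = blockQd A B C := by
  set N : Matrix (Fin m ⊕ Fin n) (Fin m ⊕ Fin n) ℂ :=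
    Matrix.fromBlocks (A * drazinPi A) 0 (C * drazinPi A) 0 with hN
  have hB' : A * drazinInv A * B = B := by
    rw [drazinPi, Matrix.sub_mul, Matrix.one_mul, sub_eq_zero] at hB
    exact hB.symm
  have hsum : Matrix.fromBlocks A B C D = N + blockQ A B C := by
    rw [hN, blockQ, Matrix.fromBlocks_add, hB', zero_add, zero_add, ← sub_eq_zero.1 hZ, drazinPi,
      mul_sub, Matrix.mul_sub, mul_one, Matrix.mul_one, pow_two, ← mul_assoc, sub_add_cancel,
      ← Matrix.mul_assoc, sub_add_cancel]
  have hQN : blockQ A B C * N = 0 := by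
    have hA : A ^ 2 * drazinInv A * (A * drazinPi A) = 0 := by
      rw [mul_drazinPi, ← mul_assoc, mul_assoc _ _ (drazinPi A), drazinInv_mul_drazinPi, mul_zero,
        zero_mul]
    have hCA : C * A * drazinInv A * (A * drazinPi A) = 0 := by
      rw [mul_drazinPi, ← Matrix.mul_assoc, Matrix.mul_assoc _ _ (drazinPi A),
        drazinInv_mul_drazinPi, Matrix.mul_zero, Matrix.zero_mul]
    have hCB : C * drazinInv A * B * (C * drazinPi A) = 0 := by
      rw [Matrix.mul_assoc _ B, ← Matrix.mul_assoc B, hBC, Matrix.mul_zero]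
    rw [hN, blockQ, Matrix.fromBlocks_multiply, hB', hA, hCA, hCB, ← Matrix.mul_assoc B, hBC]
    simp
  have hNQ : N * blockQ A B C = 0 := by
    have hA : drazinPi A * (A ^ 2 * drazinInv A) = 0 := by
      rw [← mul_assoc, ← commute_pow_drazinPi, mul_assoc, drazinPi_mul_drazinInv, mul_zero]
    rw [hN, blockQ, Matrix.fromBlocks_multiply, hB', mul_assoc, Matrix.mul_assoc A,
      Matrix.mul_assoc C (drazinPi A) B, Matrix.mul_assoc C _ (_ * _), hA, hB]
    simp
  have hpow : ∀ j : ℕ, N ^ (j + 1) =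
      Matrix.fromBlocks (A ^ (j + 1) * drazinPi A) 0 (C * (A ^ j * drazinPi A)) 0 := by
    intro j
    induction j with
    | zero => simp [hN]
    | succ j ih =>
      rw [pow_succ, ih, hN, Matrix.fromBlocks_multiply]
      simp only [Matrix.zero_mul, Matrix.mul_zero, add_zero]
      have e : ∀ i : ℕ, A ^ i * drazinPi A * (A * drazinPi A) = A ^ (i + 1) * drazinPi A := by
        intro i
        rw [mul_drazinPi, mul_assoc, ← mul_assoc (drazinPi A), drazinPi_mul_self, ← mul_drazinPi,
          ← mul_assoc, ← pow_succ]
      rw [e, Matrix.mul_assoc, e]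
  have hnil : N ^ (matIndex A + 1) = 0 := by
    rw [hpow, pow_mul_drazinPi_eq_zero A (Nat.le_succ _), pow_mul_drazinPi_eq_zero A le_rfl,
      Matrix.mul_zero, Matrix.fromBlocks_zero]
  have hNd := mul_blockQd_eq_zero A B C hNQ
  rw [hsum, ((isDrazin_blockQ A B C).add_of_mul_eq_zero hQN hnil).drazinInv_eq,
    Finset.sum_range_succ', Finset.sum_eq_zero, zero_add, pow_zero, one_mul, zero_add, pow_one]
  intro j _
  rw [pow_succ N, pow_succ' (blockQd A B C), mul_assoc, ← mul_assoc N, hNd, zero_mul, mul_zero]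

end Blocks

theorem corollary4p6 (m n : ℕ) (A : Matrix (Fin m) (Fin m) ℂ) (B : Matrix (Fin m) (Fin n) ℂ)
    (C : Matrix (Fin n) (Fin m) ℂ) (D : Matrix (Fin n) (Fin n) ℂ) :
    drazinInv (blockQ A B C) = blockQd A B C ∧
    (genSchur A B C D = 0 → C * drazinPi A = 0 →
      drazinInv (Matrix.fromBlocks A B C D) =
        blockQd A B C +
          ∑ j ∈ Finset.Icc 1 (matIndex A),
            Matrix.fromBlocks 0 (A ^ (j - 1) * drazinPi A * B) 0 0 * blockQd A B C ^ (j + 1)) ∧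
    (genSchur A B C D = 0 → drazinPi A * B = 0 → B * C * drazinPi A = 0 →
      drazinInv (Matrix.fromBlocks A B C D) = blockQd A B C) :=
  ⟨(isDrazin_blockQ A B C).drazinInv_eq, drazinInv_fromBlocks_of_mul_drazinPi_eq_zero A B C D,
    drazinInv_fromBlocks_of_drazinPi_mul_eq_zero A B C D⟩
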